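/- Let $k\ge 2$. Call a set $E\subseteq H^k$ of $k$-tuples on a finite set $H$ a *$k$-full hypergraph* if $E=E^*\cup E^{<k}$, where $E^*$ is symmetric and holds only on tuples of $k$ distinct elements, and $E^{<k}$ is the set of all $k$-tuples with fewer than $k$ distinct entries. A *template* of arity $k$ is a sequence $\mathcal H=\langle (H_n,E_n):n<\omega\rangle$ of $k$-full hypergraphs on vertex sets $H_n=\{0,\dots,|H_n|-1\}$ for which there is a function $f:\omega\to\omega\setminus\{0\}$ with $f(n)\to\infty$ such that for all $n$: $f(n)\le |H_n|<\aleph_0$, and for any $f(n)$ many $(k-1)$-tuples $\bar\imath^{\,\ell}$ $(\ell<f(n))$ from $H_n$ there is $s\in H_n$ with $\langle s\rangle^\smallfrown\bar\imath^{\,\ell}\in E_n$ for all $\ell<f(n)$. Let $X_{\mathcal H}$ be the tree of finite sequences $\eta$ with $\eta(n)\in H_n$ for all $n<\operatorname{lgn}(\eta)$. Let $T_0(\mathcal H)$ be the universal theory, in the language with equality, a $k$-place relation $R$ and unary predicates $Q_\eta$ $(\eta\in X_{\mathcal H})$, which says: $R$ is symmetric and holds only on tuples of distinct elements; $Q_{\langle\rangle}$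 holds of everything, and $Q_\nu\subseteq Q_\eta$ when $\eta\trianglelefteq\nu$; for each $\eta\in X_{\mathcal H}$ of length $m$ the predicates $Q_{\eta^\smallfrown\langle i\rangle}$ $(i\in H_m)$ partition $Q_\eta$; and whenever $\eta_0,\dots,\eta_{k-1}\in X_{\mathcal H}$ and $n<\min_i\operatorname{lgn}(\eta_i)$ are such that $\langle\eta_0(n),\dots,\eta_{k-1}(n)\rangle\notin E_n$, then $R(x_0,\dots,x_{k-1})$ fails for all $x_0\in Q_{\eta_0},\dots,x_{k-1}\in Q_{\eta_{k-1}}$. Let $\mathcal D$ be an ultrafilter on an infinite set $I$ with $|I|=\lambda$. It is *regular* if there is a family $\{X_\alpha:\alpha<\lambda\}\subseteq\mathcal D$ such that each $i\in I$ lies in only finitely many $X_\alpha$. It is *flexible* if for every nonstandard integer $\langle n_i:i\in I\rangle/\mathcal D$ (that is, $n_i\in\mathbb N$ and $\{i:n_i>m\}\in\mathcal D$ for every $m\in\mathbb N$) there is $\{X_\alpha:\alpha<\lambda\}\subseteq\mathcal D$ with $|\{\alpha<\lambda:i\in X_\alpha\}|\le n_i$ for all $i\in I$. It is *good for the random graph*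 if for every infinite set $S$ and all disjoint $A,B\subseteq S^I/\mathcal D$ with $|A|+|B|\le\lambda$ there is an internal set $P\subseteq S^I/\mathcal D$ (an ultraproduct of subsets of $S$) with $A\subseteq P$ and $B\cap P=\emptyset$. **Theorem.** Let $\mathcal H$ be a template of arity $k\ge 2$, let $T$ be the model completion of $T_0(\mathcal H)$, let $M\models T$, and let $\mathcal D$ be a regular ultrafilter on an infinite set $I$, $|I|=\lambda$, which is flexible and good for the random graph. Then the ultrapower $M^I/\mathcal D$ is $\lambda^+$-saturated: over every set of at most $\lambda$ parameters, every $1$-type is realized. -/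

import Mathlib

open FirstOrder

universe u

/-! ### Hypergraphs and templates -/

/-- `E`, a set of `k`-tuples from the vertex set `V`, makes `V` a `k`-full hypergraph: `E` is the
union of a `k`-uniform hypergraph `E'` (symmetric, holding only on tuples of `k` distinct vertices)
and of the set of all `k`-tuples with fewer than `k` distinct entries. -/
def IsFullHypergraph {V : Type*} {k : ℕ} (E : Set (Fin k → V)) : Prop :=
  ∃ E' : Set (Fin k → V),
    (∀ x ∈ E', Function.Injective x) ∧
    (∀ x ∈ E', ∀ σ : Equiv.Perm (Fin k), x ∘ σ ∈ E') ∧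
    E = E' ∪ {x | ¬ Function.Injective x}

/-- The requirements that the growth function `f` of a template has to meet, for the sequence of
hypergraphs `(Fin (H n), E n)` of arity `d + 1`. -/
structure IsGrowthFunction {d : ℕ} (H : ℕ → ℕ) (E : ∀ n, Set (Fin (d + 1) → Fin (H n)))
    (f : ℕ → ℕ) : Prop where
  pos : ∀ n, 0 < f n
  tendsto : Filter.Tendsto f Filter.atTop Filter.atTop
  le_card : ∀ n, f n ≤ H n
  /-- Extension: any `f n` many `d`-tuples of vertices have a common neighbour. -/
  extension : ∀ n, ∀ i : Fin (f n) → Fin d → Fin (H n),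
    ∃ s : Fin (H n), ∀ l, (Fin.cons s (i l) : Fin (d + 1) → Fin (H n)) ∈ E n

/-- A template of arity `k = d + 1 ≥ 2`: a sequence of finite `k`-full hypergraphs
`(Fin (H n), E n)` that admits a growth function. -/
structure Template (d : ℕ) where
  one_le : 1 ≤ d
  H : ℕ → ℕ
  E : ∀ n, Set (Fin (d + 1) → Fin (H n))
  full : ∀ n, IsFullHypergraph (E n)
  exists_growth : ∃ f : ℕ → ℕ, IsGrowthFunction H E f

namespace Template

variable {d : ℕ} (𝓗 : Template d)

/-- The tree of finite sequences `η` with `η n < H n` for all `n < lgn η`. -/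
def Node : Type := (m : ℕ) × ((i : Fin m) → Fin (𝓗.H i))

variable {𝓗}

/-- The length of a finite sequence. -/
def Node.lgn (η : 𝓗.Node) : ℕ := η.1

/-- The entry `η n`, for `n < lgn η`. -/
def Node.entry (η : 𝓗.Node) (n : ℕ) (hn : n < η.lgn) : Fin (𝓗.H n) := η.2 ⟨n, hn⟩

/-- The empty sequence. -/
def Node.root : 𝓗.Node := ⟨0, fun i => i.elim0⟩

/-- The sequence `η` with the further entry `i` at its end. -/
def Node.snoc (η : 𝓗.Node) (i : Fin (𝓗.H η.lgn)) : 𝓗.Node :=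
  ⟨η.lgn + 1, Fin.snoc (α := fun j : Fin (η.lgn + 1) => Fin (𝓗.H j)) η.2 i⟩

/-- `η` is an initial segment of `ν`. -/
def Node.IsPrefix (η ν : 𝓗.Node) : Prop :=
  ∃ h : η.lgn ≤ ν.lgn, ∀ n (hn : n < η.lgn), η.entry n hn = ν.entry n (hn.trans_le h)

variable (𝓗)

/-- The relation symbols: `R` of arity `d + 1`, and a unary `Q η` for each `η` in the tree. -/
inductive Rel : ℕ → Type
  | R : Rel (d + 1)
  | Q (η : 𝓗.Node) : Rel 1

/-- The language of the template (equality is built in). -/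
def language : FirstOrder.Language.{0, 0} := ⟨fun _ => Empty, 𝓗.Rel⟩

/-- The symbol `R` as a relation symbol of the language. -/
def relR : 𝓗.language.Relations (d + 1) := Rel.R

/-- The symbol `Q η` as a relation symbol of the language. -/
def relQ (η : 𝓗.Node) : 𝓗.language.Relations 1 := Rel.Q η

/-- The atomic formula `R (x_{g 0}, …, x_{g d})`. -/
def atomR {n : ℕ} (g : Fin (d + 1) → Fin n) : 𝓗.language.BoundedFormula Empty n :=
  𝓗.relR.boundedFormula fun i => FirstOrder.Language.Term.var (Sum.inr (g i))

/-- The atomic formula `Q_η (x_i)`. -/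
def atomQ {n : ℕ} (η : 𝓗.Node) (i : Fin n) : 𝓗.language.BoundedFormula Empty n :=
  (𝓗.relQ η).boundedFormula fun _ => FirstOrder.Language.Term.var (Sum.inr i)

/-- The formula `x_i = x_j`. -/
def atomEq {n : ℕ} (i j : Fin n) : 𝓗.language.BoundedFormula Empty n :=
  (FirstOrder.Language.Term.var (Sum.inr i)).bdEqual (FirstOrder.Language.Term.var (Sum.inr j))

/-- The axioms of the universal theory of the template; `alls` is the universal closure. -/
inductive IsAxiom : 𝓗.language.Sentence → Prop
  /-- `R` is invariant under permutations. -/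
  | symm (σ : Equiv.Perm (Fin (d + 1))) :
      IsAxiom ((𝓗.atomR id).imp (𝓗.atomR σ)).alls
  /-- `R` holds only on tuples of distinct elements. -/
  | irrefl (i j : Fin (d + 1)) (hij : i ≠ j) :
      IsAxiom ((𝓗.atomR id).imp (𝓗.atomEq i j).not).alls
  /-- `Q` of the empty sequence names everything. -/
  | root : IsAxiom (𝓗.atomQ Node.root (0 : Fin 1)).alls
  /-- `Q ν` refines `Q η` for `η ⊴ ν`. -/
  | refine (η ν : 𝓗.Node) (h : η.IsPrefix ν) :
      IsAxiom ((𝓗.atomQ ν (0 : Fin 1)).imp (𝓗.atomQ η 0)).alls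
  /-- The predicates of the immediate successors of `η` are disjoint. -/
  | disjoint (η : 𝓗.Node) (i j : Fin (𝓗.H η.lgn)) (hij : i ≠ j) :
      IsAxiom (𝓗.atomQ (η.snoc i) (0 : Fin 1) ⊓ 𝓗.atomQ (η.snoc j) 0).not.alls
  /-- The predicates of the immediate successors of `η` cover `Q η`. -/
  | cover (η : 𝓗.Node) :
      IsAxiom ((𝓗.atomQ η (0 : Fin 1)).imp
        (FirstOrder.Language.BoundedFormula.iSup fun i : Fin (𝓗.H η.lgn) => 𝓗.atomQ (η.snoc i) 0)).alls
  /-- A non-edge of the `n`-th hypergraph forbids `R`-edges across the corresponding predicates. -/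
  | forbid (η : Fin (d + 1) → 𝓗.Node) (n : ℕ) (hn : ∀ i, n < (η i).lgn)
      (h : (fun i => (η i).entry n (hn i)) ∉ 𝓗.E n) :
      IsAxiom ((FirstOrder.Language.BoundedFormula.iInf fun i => 𝓗.atomQ (η i) i).imp (𝓗.atomR id).not).alls

/-- The universal theory of the template. -/
def universalTheory : 𝓗.language.Theory := {φ | 𝓗.IsAxiom φ}

end Template

/-! ### Model completions and saturation -/

/-- `T` is a model completion of `T₀`: every model of `T` is a model of `T₀`, every model of `T₀`
embeds into a model of `T`, and for every `M ⊨ T₀` the theory `T` together with the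
(quantifier-free) diagram of `M` is complete, that is, any two models of `T` into which `M` is
embedded satisfy the same formulas with parameters from `M`. -/
structure IsModelCompletion {L : FirstOrder.Language.{0, 0}} (T₀ T : L.Theory) : Prop where
  extends_theory : ∀ (N : Type u) [L.Structure N] [Nonempty N], N ⊨ T → N ⊨ T₀
  exists_embedding : ∀ (M : Type u) [L.Structure M] [Nonempty M], M ⊨ T₀ →
    ∃ (N : Type u) (_ : L.Structure N), N ⊨ T ∧ Nonempty (M ↪[L] N)
  complete_diagram : ∀ (M N₁ N₂ : Type u) [L.Structure M] [L.Structure N₁] [L.Structure N₂]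
    [Nonempty M], M ⊨ T₀ → N₁ ⊨ T → N₂ ⊨ T → ∀ (f₁ : M ↪[L] N₁) (f₂ : M ↪[L] N₂)
    (n : ℕ) (φ : L.Formula (Fin n)) (v : Fin n → M), φ.Realize (f₁ ∘ v) ↔ φ.Realize (f₂ ∘ v)

/-- `N` is `κ`-saturated: over every set `A` of fewer than `κ` parameters, every `1`-type `p`
(a set of formulas over `A` that is finitely satisfiable in `N`) is realized in `N`. -/
def IsSaturated (L : FirstOrder.Language.{0, 0}) (N : Type u) [L.Structure N] (κ : Cardinal.{u}) : Prop :=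
  ∀ A : Set N, Cardinal.mk A < κ → ∀ p : Set (L[[A]].Formula Unit),
    (∀ s ⊆ p, s.Finite → ∃ a : N, ∀ φ ∈ s, φ.Realize fun _ => a) →
    ∃ a : N, ∀ φ ∈ p, φ.Realize fun _ => a

/-! ### Ultrafilters -/

/-- The ultrapower `M ^ I / D`. -/
abbrev Ultrapower {I : Type u} (D : Ultrafilter I) (M : Type u) : Type u :=
  (D : Filter I).Product fun _ => M

/-- The ultrafilter `D` on `I` is regular: there is a family of `|I|` many elements of `D` such that
each point of `I` lies in only finitely many of them. -/
def Ultrafilter.IsRegular {I : Type u} (D : Ultrafilter I) : Prop :=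
  ∃ X : I → Set I, (∀ α, X α ∈ D) ∧ ∀ i, {α | i ∈ X α}.Finite

/-- The ultrafilter `D` on `I` is flexible: below any nonstandard integer `n = ⟨n i : i ∈ I⟩ / D`
there is a regularizing family of `|I|` many elements of `D`. -/
def Ultrafilter.IsFlexible {I : Type u} (D : Ultrafilter I) : Prop :=
  ∀ n : I → ℕ, (∀ m : ℕ, ∀ᶠ i in (D : Filter I), m < n i) →
    ∃ X : I → Set I, (∀ α, X α ∈ D) ∧ ∀ i, {α | i ∈ X α}.encard ≤ n i

/-- A subset of an ultrapower is internal if it is an ultraproduct of subsets `S i` of the factors. -/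
def IsInternal {I : Type u} (D : Ultrafilter I) {M : Type u} (P : Set (Ultrapower D M)) : Prop :=
  ∃ S : I → Set M, ∀ x : I → M, (x : Ultrapower D M) ∈ P ↔ ∀ᶠ i in (D : Filter I), x i ∈ S i

/-- The ultrafilter `D` on `I` is good for the random graph: in every ultrapower of an infinite set,
disjoint sets `A`, `B` with `|A| + |B| ≤ |I|` are separated by an internal set. -/
def Ultrafilter.IsGoodForRandomGraph {I : Type u} (D : Ultrafilter I) : Prop :=
  ∀ (M : Type u) [Infinite M] (A B : Set (Ultrapower D M)),
    Cardinal.mk A + Cardinal.mk B ≤ Cardinal.mk I → Disjoint A B →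
    ∃ P : Set (Ultrapower D M), IsInternal D P ∧ A ⊆ P ∧ Disjoint B P

/-! A model of the universal theory is a set of points, each following an infinite branch of the
tree, with a symmetric relation on distinct points whose edges project into `E n` at every level
`n`. Since `T` is a model completion, the type over `A` of a point outside `A` is determined by its
branch `ρ` and by the `d`-tuples from `A` to which it is joined. Saturation thus reduces to
realizing such data (`exists_point_ultrapower`), and the data are read off from a realization in a
further ultrapower (`exists_realize_iff`).

The obstacle is that representatives of a tuple to be joined are guaranteed to be compatible with
`ρ` only up to a nonstandard level that depends on the tuple. Goodness for the random graph is used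
twice: to separate the tuples to be joined from the others by an internal set, and to find one
nonstandard level `n` below all those levels. Below `n` the new point follows `ρ`. From `n` on its
branch is free, and the template supplies vertices adjacent to all `d`-tuples from `r` parameters as
long as `r ^ d ≤ f k` for `k ≥ n`. Since `f` tends to infinity, `r` can be taken nonstandard, and
flexibility distributes `A` so that each index sees at most `r` parameters and each parameter is
seen almost everywhere. The points at the single indices come from `exists_point`: a one-point
extension of `M` embeds into a model of `T`, and its existential content passes down to `M`. -/

namespace Template

/-! ### Models of the universal theory as sets of points on branches -/

open FirstOrder.Language Structure

variable {d : ℕ} {𝓗 : Template d}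

/-- The initial segment of length `m` of an infinite branch. -/
def Node.ofBranch (ρ : ∀ n, Fin (𝓗.H n)) (m : ℕ) : 𝓗.Node := ⟨m, fun i => ρ i⟩

theorem Node.eq_ofBranch (η : 𝓗.Node) (ρ : ∀ n, Fin (𝓗.H n))
    (h : ∀ n hn, η.entry n hn = ρ n) : η = Node.ofBranch ρ η.lgn := by
  obtain ⟨m, x⟩ := η
  have : x = fun i : Fin m => ρ i := funext fun i => h i i.2
  subst this
  rfl

theorem Node.snoc_ofBranch (ρ : ∀ n, Fin (𝓗.H n)) (m : ℕ) :
    (Node.ofBranch ρ m).snoc (ρ m) = Node.ofBranch ρ (m + 1) := by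
  have : (Fin.snoc (α := fun j : Fin (m + 1) => Fin (𝓗.H j)) (fun i : Fin m => ρ i) (ρ m)) =
      fun i : Fin (m + 1) => ρ i := by
    funext i
    refine Fin.lastCases ?_ (fun j => ?_) i
    · simp
    · simp
  exact congrArg (fun x => (⟨m + 1, x⟩ : 𝓗.Node)) this

theorem Node.isPrefix_snoc_ofBranch (η : 𝓗.Node) (ρ : ∀ n, Fin (𝓗.H n)) (m : ℕ)
    (hm : m < η.lgn) (h : ∀ n (hn : n < m), η.entry n (hn.trans hm) = ρ n) :
    ((Node.ofBranch ρ m).snoc (η.entry m hm)).IsPrefix η := by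
  refine ⟨hm, fun n hn => ?_⟩
  change Fin.snoc (α := fun j : Fin (m + 1) => Fin (𝓗.H j)) (fun i : Fin m => ρ i)
    (η.entry m hm) ⟨n, hn⟩ = _
  rcases Nat.lt_succ_iff_lt_or_eq.1 hn with h' | rfl
  · exact (Fin.snoc_castSucc (α := fun j : Fin (m + 1) => Fin (𝓗.H j)) _ _ ⟨n, h'⟩).trans
      (h n h').symm
  · exact Fin.snoc_last (α := fun j : Fin (n + 1) => Fin (𝓗.H j)) _ _

/-- The edge relation of a structure. -/
def Edge (𝓗 : Template d) {M : Type*} [𝓗.language.Structure M] (x : Fin (d + 1) → M) : Prop :=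
  RelMap 𝓗.relR x

/-- `Lies η a`: the predicate of the node `η` holds of `a`. -/
def Lies {M : Type*} [𝓗.language.Structure M] (η : 𝓗.Node) (a : M) : Prop :=
  RelMap (𝓗.relQ η) fun _ : Fin 1 => a

/-- The semantic content of the universal theory: each element `a` follows an infinite
branch `br a`, and `R` is a symmetric irreflexive relation whose edges project to edges of
each of the hypergraphs. -/
structure IsBranching (𝓗 : Template d) {M : Type*} [𝓗.language.Structure M]
    (br : M → ∀ n, Fin (𝓗.H n)) : Prop where
  lies_iff : ∀ (η : 𝓗.Node) (a : M), Lies η a ↔ ∀ n hn, η.entry n hn = br a n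
  symm : ∀ (x : Fin (d + 1) → M) (σ : Equiv.Perm (Fin (d + 1))), 𝓗.Edge x → 𝓗.Edge (x ∘ σ)
  injective : ∀ x : Fin (d + 1) → M, 𝓗.Edge x → Function.Injective x
  mem_edges : ∀ x : Fin (d + 1) → M, 𝓗.Edge x → ∀ n, (fun i => br (x i) n) ∈ 𝓗.E n

section Atoms

variable {M : Type*} [𝓗.language.Structure M]

theorem IsBranching.model {br : M → ∀ n, Fin (𝓗.H n)} (h : 𝓗.IsBranching br) :
    M ⊨ 𝓗.universalTheory := by
  rw [Theory.model_iff]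
  intro φ hφ
  cases hφ with
  | symm σ =>
    refine BoundedFormula.realize_alls.2 fun x => ?_
    exact h.symm x σ
  | irrefl i j hij =>
    refine BoundedFormula.realize_alls.2 fun x => ?_
    exact fun hx hx' => hij (h.injective x hx hx')
  | root =>
    refine BoundedFormula.realize_alls.2 fun x => ?_
    exact (h.lies_iff _ _).2 fun n hn => absurd hn (Nat.not_lt_zero n)
  | refine η ν hp =>
    refine BoundedFormula.realize_alls.2 fun x => fun hx => ?_
    obtain ⟨hle, hp⟩ := hp
    exact (h.lies_iff _ _).2 fun n hn => (hp n hn).trans ((h.lies_iff _ _).1 hx n _)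
  | disjoint η i j hij =>
    refine BoundedFormula.realize_alls.2 fun x => ?_
    rw [BoundedFormula.realize_not, BoundedFormula.realize_inf]
    rintro ⟨h1, h2⟩
    have e1 := (h.lies_iff _ _).1 h1 η.lgn (Nat.lt_succ_self _)
    have e2 := (h.lies_iff _ _).1 h2 η.lgn (Nat.lt_succ_self _)
    have key : ∀ i, (η.snoc i).entry η.lgn (Nat.lt_succ_self _) = i := fun i =>
      Fin.snoc_last (α := fun j : Fin (η.lgn + 1) => Fin (𝓗.H j)) i η.2
    rw [key] at e1 e2
    exact hij (e1.trans e2.symm)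
  | cover η =>
    refine BoundedFormula.realize_alls.2 fun x => ?_
    rw [BoundedFormula.realize_imp, BoundedFormula.realize_iSup]
    intro hx
    refine ⟨br (x 0) η.lgn, ?_⟩
    refine (h.lies_iff _ (x 0)).2 ?_
    rw [η.eq_ofBranch _ ((h.lies_iff _ (x 0)).1 hx)]
    intro n hn
    have := Node.snoc_ofBranch (br (x 0)) η.lgn
    change ((Node.ofBranch (br (x 0)) η.lgn).snoc (br (x 0) η.lgn)).entry n hn = _
    simp only [this]
    rfl
  | forbid η n hn hE =>
    refine BoundedFormula.realize_alls.2 fun x => ?_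
    rw [BoundedFormula.realize_imp, BoundedFormula.realize_iInf]
    intro hx hR
    refine hE ?_
    have := h.mem_edges x hR n
    convert this using 2 with i
    exact (h.lies_iff _ _).1 (hx i) n (hn i)

/-- The covering axioms allow a branch to be built by recursion, and disjointness makes it unique.
-/
theorem exists_isBranching (hM : M ⊨ 𝓗.universalTheory) :
    ∃ br : M → ∀ n, Fin (𝓗.H n), 𝓗.IsBranching br := by
  have key : ∀ {φ}, 𝓗.IsAxiom φ → M ⊨ φ := fun {φ} hφ => (Theory.model_iff _).1 hM φ hφ
  have hroot : ∀ a : M, Lies (𝓗 := 𝓗) Node.root a := fun a =>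
    BoundedFormula.realize_alls.1 (key IsAxiom.root) fun _ => a
  have hrefine : ∀ (η ν : 𝓗.Node), η.IsPrefix ν → ∀ a : M, Lies ν a → Lies η a := fun η ν h a =>
    BoundedFormula.realize_alls.1 (key (IsAxiom.refine η ν h)) fun _ => a
  have hdisj : ∀ (η : 𝓗.Node) i j, i ≠ j → ∀ a : M, Lies (η.snoc i) a → ¬ Lies (η.snoc j) a := by
    intro η i j hij a h1 h2
    have := BoundedFormula.realize_alls.1 (key (IsAxiom.disjoint η i j hij)) fun _ => a
    rw [BoundedFormula.realize_not, BoundedFormula.realize_inf] at this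
    exact this ⟨h1, h2⟩
  have hcover : ∀ (η : 𝓗.Node) (a : M), Lies η a → ∃ i, Lies (η.snoc i) a := by
    intro η a h
    have := BoundedFormula.realize_alls.1 (key (IsAxiom.cover η)) fun _ => a
    rw [BoundedFormula.realize_imp, BoundedFormula.realize_iSup] at this
    exact this h
  have hbr : ∀ a : M, ∃ ρ : ∀ n, Fin (𝓗.H n), ∀ m, Lies (Node.ofBranch ρ m) a := by
    intro a
    let g : ∀ m, {x : (i : Fin m) → Fin (𝓗.H i) // Lies (⟨m, x⟩ : 𝓗.Node) a} := fun m =>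
      Nat.rec ⟨_, hroot a⟩ (fun m x => ⟨_, (hcover ⟨m, x.1⟩ a x.2).choose_spec⟩) m
    have hg : ∀ m (i : Fin m), (g (m + 1)).1 i.castSucc = (g m).1 i := fun m i =>
      Fin.snoc_castSucc (α := fun j : Fin (m + 1) => Fin (𝓗.H j)) _ (g m).1 i
    -- The nodes `g m` extend one another, so the last entry of `g (n + 1)` is the `n`-th entry of
    -- all later ones.
    refine ⟨fun n => (g (n + 1)).1 (Fin.last n), fun m => ?_⟩
    have : ∀ i : Fin m, (g m).1 i = (g (i + 1)).1 (Fin.last i) := by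
      induction m with
      | zero => exact fun i => i.elim0
      | succ m ih =>
        intro i
        refine Fin.lastCases ?_ (fun j => ?_) i
        · rfl
        · rw [hg]
          exact ih j
    rw [Node.ofBranch, ← funext this]
    exact (g m).2
  choose br hbr using hbr
  have hl : ∀ (η : 𝓗.Node) (a : M), Lies η a ↔ ∀ n hn, η.entry n hn = br a n := by
    refine fun η a => ⟨fun h n => ?_, fun h => ?_⟩
    -- At a first disagreement `a` would lie on two distinct successors of the same node.
    · induction n using Nat.strong_induction_on with
      | _ n ih =>
        intro hn
        by_contra hne
        refine hdisj (Node.ofBranch (br a) n) _ _ hne a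
          (hrefine _ _ (η.isPrefix_snoc_ofBranch _ n hn fun k hk => ih k hk _) a h) ?_
        rw [Node.snoc_ofBranch]
        exact hbr a _
    · rw [η.eq_ofBranch _ h]
      exact hbr a _
  refine ⟨br, hl, fun x σ hx => ?_, fun x hx i j hij => ?_, fun x hx n => ?_⟩
  · exact BoundedFormula.realize_alls.1 (key (IsAxiom.symm σ)) x hx
  · by_contra hne
    exact BoundedFormula.realize_alls.1 (key (IsAxiom.irrefl i j hne)) x hx hij
  · by_contra hE
    have := BoundedFormula.realize_alls.1 (key (IsAxiom.forbid
      (fun i => Node.ofBranch (br (x i)) (n + 1)) n (fun _ => Nat.lt_succ_self n) hE)) x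
    rw [BoundedFormula.realize_imp, BoundedFormula.realize_iInf] at this
    exact this (fun i => hbr _ _) hx

end Atoms

end Template

/-! ### Permutations of tuples -/

theorem IsFullHypergraph.comp_perm_mem {V : Type*} {k : ℕ} {E : Set (Fin k → V)}
    (hE : IsFullHypergraph E) {x : Fin k → V} (hx : x ∈ E) (σ : Equiv.Perm (Fin k)) :
    x ∘ σ ∈ E := by
  obtain ⟨E', -, hsymm, rfl⟩ := hE
  rcases hx with hx | hx
  · exact Or.inl (hsymm x hx σ)
  · refine Or.inr fun h => hx ?_
    have := h.comp σ.symm.injective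
    rwa [Function.comp_assoc, Equiv.self_comp_symm] at this

/-- A permutation of the last `d` coordinates extends to one fixing `0`; symmetry of a `(d + 1)`-ary
relation thereby passes to the `d`-tuples related to a fixed point. -/
theorem Fin.cons_comp_decomposeFin_symm {α : Type*} {d : ℕ} (c : α) (x : Fin d → α)
    (σ : Equiv.Perm (Fin d)) :
    (Fin.cons c x : Fin (d + 1) → α) ∘ Equiv.Perm.decomposeFin.symm (0, σ) =
      Fin.cons c (x ∘ σ) := by
  funext i
  refine Fin.cases ?_ (fun j => ?_) i
  · simp
  · simp [Equiv.Perm.decomposeFin_symm_apply_succ]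

theorem Fin.comp_cons_apply {α β : Type*} {d : ℕ} (f : α → β) (c : α) (x : Fin d → α) :
    (fun i => f ((Fin.cons c x : Fin (d + 1) → α) i)) = Fin.cons (f c) fun l => f (x l) := by
  funext i
  refine Fin.cases ?_ (fun j => ?_) i <;> simp

namespace IsModelCompletion

open FirstOrder.Language

/-- Completeness of the diagram for formulas with arbitrary index sets of free variables. -/
theorem realize_iff {L : FirstOrder.Language.{0, 0}} {T₀ T : L.Theory}
    (hT : IsModelCompletion.{u} T₀ T) {M N₁ N₂ : Type u} [L.Structure M] [L.Structure N₁]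
    [L.Structure N₂] [Nonempty M] (hM : M ⊨ T₀) (h₁ : N₁ ⊨ T) (h₂ : N₂ ⊨ T) (f₁ : M ↪[L] N₁)
    (f₂ : M ↪[L] N₂) {α : Type*} (φ : L.Formula α) (v : α → M) :
    φ.Realize (f₁ ∘ v) ↔ φ.Realize (f₂ ∘ v) := by
  classical
  let e := φ.freeVarFinset.equivFin
  let ψ : L.Formula (Fin φ.freeVarFinset.card) := φ.restrictFreeVar e
  have key : ∀ {N : Type u} [L.Structure N] (f : M → N),
      φ.Realize (f ∘ v) ↔ ψ.Realize (f ∘ fun i => v (e.symm i)) := by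
    intro N _ f
    refine (BoundedFormula.realize_restrictFreeVar (f ∘ v) fun a => ?_).symm
    simp
  rw [key, key]
  exact hT.complete_diagram M N₁ N₂ hM h₁ h₂ f₁ f₂ _ ψ _

end IsModelCompletion

/-! ### One-point extensions and the extension property inside a model -/

namespace Template

open FirstOrder.Language Structure

variable {d : ℕ} {𝓗 : Template d}

section Embeddings

variable {M N : Type*} [𝓗.language.Structure M] [𝓗.language.Structure N]

theorem edge_embedding (f : M ↪[𝓗.language] N) (x : Fin (d + 1) → M) :
    𝓗.Edge (fun i => f (x i)) ↔ 𝓗.Edge x := f.map_rel 𝓗.relR x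

theorem lies_embedding (f : M ↪[𝓗.language] N) (η : 𝓗.Node) (a : M) :
    Lies η (f a) ↔ Lies η a := f.map_rel (𝓗.relQ η) fun _ => a

/-- An injective map that preserves and reflects the relations is an embedding. -/
def embeddingOfIff (f : M → N) (hf : Function.Injective f)
    (hE : ∀ x : Fin (d + 1) → M, 𝓗.Edge (fun i => f (x i)) ↔ 𝓗.Edge x)
    (hQ : ∀ (η : 𝓗.Node) (a : M), Lies η (f a) ↔ Lies η a) : M ↪[𝓗.language] N where
  toFun := f
  inj' := hf
  map_fun' g := nomatch g
  map_rel' {n} r x := by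
    cases r with
    | R => exact hE x
    | Q η =>
      have hx : x = fun _ => x 0 := funext fun i => congrArg x (Subsingleton.elim _ _)
      have hx' : f ∘ x = fun _ => f (x 0) := by rw [hx]; rfl
      rw [hx', hx]
      exact hQ η (x 0)

theorem IsBranching.branch_eq {br : M → ∀ n, Fin (𝓗.H n)} (h : 𝓗.IsBranching br) {a : M}
    {ρ : ∀ n, Fin (𝓗.H n)} {m : ℕ} (ha : Lies (Node.ofBranch ρ m) a) {n : ℕ} (hn : n < m) :
    br a n = ρ n :=
  ((h.lies_iff _ a).1 ha n hn).symm

theorem IsBranching.lies_ofBranch {br : M → ∀ n, Fin (𝓗.H n)} (h : 𝓗.IsBranching br) (a : M)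
    (m : ℕ) : Lies (Node.ofBranch (br a) m) a :=
  (h.lies_iff _ a).2 fun _ _ => rfl

theorem IsBranching.edge_comp_perm_iff {br : M → ∀ n, Fin (𝓗.H n)} (h : 𝓗.IsBranching br)
    (x : Fin (d + 1) → M) (σ : Equiv.Perm (Fin (d + 1))) :
    𝓗.Edge (x ∘ σ) ↔ 𝓗.Edge x := by
  refine ⟨fun hx => ?_, h.symm x σ⟩
  have := h.symm _ σ.symm hx
  rwa [Function.comp_assoc, Equiv.self_comp_symm] at this

end Embeddings

/-- The structure with a given edge relation and given branches. -/
@[reducible]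
def structureOfBranches {M : Type*} (R : Set (Fin (d + 1) → M)) (br : M → ∀ n, Fin (𝓗.H n)) :
    𝓗.language.Structure M where
  funMap f := nomatch f
  RelMap {_} r := match r with
    | Rel.R => fun x => x ∈ R
    | Rel.Q η => fun x => ∀ n hn, η.entry n hn = br (x 0) n

/-- The formula saying that there is a point other than the `v i`, on the node `η`, whose edges
with the tuples of parameters are those prescribed by `G`. -/
noncomputable def pointFormula (η : 𝓗.Node) {m : ℕ} (G : Set (Fin d → Fin m)) :
    𝓗.language.Formula (Fin m) :=
  open Classical in
  BoundedFormula.ex (n := 0)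
    ((BoundedFormula.iInf fun i : Fin m =>
        ((Term.var (Sum.inr 0)).bdEqual (Term.var (Sum.inl i))).not) ⊓
      ((𝓗.relQ η).boundedFormula fun _ => Term.var (Sum.inr 0)) ⊓
      BoundedFormula.iInf fun g : Fin d → Fin m =>
        if g ∈ G then
          𝓗.relR.boundedFormula (Fin.cons (Term.var (Sum.inr 0)) fun l => Term.var (Sum.inl (g l)))
        else
          (𝓗.relR.boundedFormula
            (Fin.cons (Term.var (Sum.inr 0)) fun l => Term.var (Sum.inl (g l)))).not)

theorem realize_pointFormula {M : Type*} [𝓗.language.Structure M] (η : 𝓗.Node) {m : ℕ}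
    (G : Set (Fin d → Fin m)) (v : Fin m → M) :
    (pointFormula η G).Realize v ↔ ∃ c : M, (∀ i, c ≠ v i) ∧ Lies η c ∧
      ∀ g : Fin d → Fin m, 𝓗.Edge (Fin.cons c fun l => v (g l)) ↔ g ∈ G := by
  classical
  have hR : ∀ (c : M) (xs : Fin 0 → M) (g : Fin d → Fin m),
      (𝓗.relR.boundedFormula (Fin.cons (Term.var (Sum.inr 0)) fun l => Term.var (Sum.inl (g l))) :
        𝓗.language.BoundedFormula (Fin m) 1).Realize v (Fin.snoc xs c) ↔
      𝓗.Edge (Fin.cons c fun l => v (g l)) := by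
    intro c xs g
    rw [BoundedFormula.realize_rel, Fin.comp_cons_apply]
    rfl
  unfold pointFormula
  rw [Formula.Realize, BoundedFormula.realize_ex]
  refine exists_congr fun c => ?_
  rw [BoundedFormula.realize_inf, BoundedFormula.realize_inf, BoundedFormula.realize_iInf,
    BoundedFormula.realize_iInf, and_assoc]
  refine and_congr (forall_congr' fun i => ?_) (and_congr Iff.rfl (forall_congr' fun g => ?_))
  · rw [BoundedFormula.realize_not]
    rfl
  · split_ifs with hg
    · rw [hR]
      simp [hg]
    · rw [BoundedFormula.realize_not, hR]
      simp [hg]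

/-- In a template with growth function `f`, at most `f n` many tuples, with coordinates in a
finite set, have a common neighbour in the `n`-th hypergraph. -/
theorem exists_common_neighbour {f : ℕ → ℕ} (hf : IsGrowthFunction 𝓗.H 𝓗.E f) {M : Type*}
    (F : Finset M) (n : ℕ) (hF : F.card ^ d ≤ f n) (b : M → Fin (𝓗.H n)) :
    ∃ s : Fin (𝓗.H n), ∀ x : Fin d → M, (∀ l, x l ∈ F) →
      (Fin.cons s fun l => b (x l) : Fin (d + 1) → Fin (𝓗.H n)) ∈ 𝓗.E n := by
  classical
  by_cases hne : Nonempty (Fin d → F)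
  · have hcard : Fintype.card (Fin d → F) ≤ Fintype.card (Fin (f n)) := by simpa using hF
    obtain ⟨e⟩ := Function.Embedding.nonempty_of_card_le hcard
    -- There may be fewer than `f n` tuples; `invFun` fills the spare slots with an arbitrary one.
    obtain ⟨s, hs⟩ := hf.extension n fun j l => b (Function.invFun e j l)
    refine ⟨s, fun x hx => ?_⟩
    have := hs (e fun l => ⟨x l, hx l⟩)
    rwa [Function.leftInverse_invFun e.injective] at this
  · exact ⟨⟨0, (hf.pos n).trans_le (hf.le_card n)⟩,
      fun x hx => absurd ⟨fun l => ⟨x l, hx l⟩⟩ hne⟩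

/-- The local extension property of models of the model completion. -/
theorem exists_point {T : 𝓗.language.Theory} (hT : IsModelCompletion.{u} 𝓗.universalTheory T)
    {f : ℕ → ℕ} (hf : IsGrowthFunction 𝓗.H 𝓗.E f) {M : Type u} [𝓗.language.Structure M]
    [Nonempty M] (hM : M ⊨ T) {br : M → ∀ n, Fin (𝓗.H n)} (hbr : 𝓗.IsBranching br)
    (ρ : ∀ n, Fin (𝓗.H n)) (m : ℕ) (F : Finset M) (hF : ∀ n, m ≤ n → F.card ^ d ≤ f n)
    (P : Set (Fin d → M)) (hsymm : ∀ x ∈ P, ∀ σ : Equiv.Perm (Fin d), x ∘ σ ∈ P)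
    (hinj : ∀ x ∈ P, Function.Injective x)
    (hE : ∀ x ∈ P, ∀ n < m,
      (Fin.cons (ρ n) fun l => br (x l) n : Fin (d + 1) → Fin (𝓗.H n)) ∈ 𝓗.E n) :
    ∃ c : M, c ∉ F ∧ Lies (Node.ofBranch ρ m) c ∧
      ∀ x : Fin d → M, (∀ l, x l ∈ F) → (𝓗.Edge (Fin.cons c x) ↔ x ∈ P) := by
  classical
  -- The branch of the new point: `ρ` below level `m`, and from `m` on a vertex adjacent to every
  -- tuple from `F`, so that these levels forbid no edge.
  have hs : ∀ n, ∃ s : Fin (𝓗.H n), (n < m → s = ρ n) ∧ (m ≤ n → ∀ x : Fin d → M,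
      (∀ l, x l ∈ F) →
      (Fin.cons s fun l => br (x l) n : Fin (d + 1) → Fin (𝓗.H n)) ∈ 𝓗.E n) := by
    intro n
    rcases lt_or_ge n m with h | h
    · exact ⟨ρ n, fun _ => rfl, fun h' => absurd h (not_lt.2 h')⟩
    · obtain ⟨s, hs⟩ := exists_common_neighbour hf F n (hF n h) fun a => br a n
      exact ⟨s, fun h' => absurd h' (not_lt.2 h), fun _ => hs⟩
  choose s hs₁ hs₂ using hs
  let R : Set (Fin (d + 1) → Option M) := {y | (∃ x, 𝓗.Edge x ∧ y = fun i => some (x i)) ∨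
    ∃ (σ : Equiv.Perm (Fin (d + 1))) (x : Fin d → M), x ∈ P ∧ (∀ l, x l ∈ F) ∧
      y = (Fin.cons none fun l => some (x l) : Fin (d + 1) → Option M) ∘ σ}
  let br' : Option M → ∀ n, Fin (𝓗.H n) := fun a => a.elim s br
  let _ : 𝓗.language.Structure (Option M) := structureOfBranches R br'
  have hedge : ∀ y : Fin (d + 1) → Option M, 𝓗.Edge y ↔ y ∈ R := fun y => Iff.rfl
  have hbr' : 𝓗.IsBranching br' := by
    refine ⟨fun η a => Iff.rfl, fun y σ hy => ?_, fun y hy => ?_, fun y hy n => ?_⟩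
    · rcases hy with ⟨x, hx, rfl⟩ | ⟨τ, x, hx, hxF, rfl⟩
      · exact Or.inl ⟨x ∘ σ, hbr.symm x σ hx, rfl⟩
      · exact Or.inr ⟨σ.trans τ, x, hx, hxF, rfl⟩
    · rcases hy with ⟨x, hx, rfl⟩ | ⟨τ, x, hx, hxF, rfl⟩
      · exact (Option.some_injective M).comp (hbr.injective x hx)
      · refine Function.Injective.comp (Fin.cons_injective_iff.2 ⟨?_, ?_⟩) τ.injective
        · rintro ⟨l, hl⟩
          cases hl
        · exact (Option.some_injective M).comp (hinj x hx)
    · rcases hy with ⟨x, hx, rfl⟩ | ⟨τ, x, hx, hxF, rfl⟩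
      · exact hbr.mem_edges x hx n
      · refine (𝓗.full n).comp_perm_mem
          (x := fun i => br' ((Fin.cons none fun l => some (x l) : Fin (d + 1) → Option M) i) n)
          ?_ τ
        rw [Fin.comp_cons_apply fun a => br' a n]
        rcases lt_or_ge n m with h | h
        · have := hE x hx n h
          rw [← hs₁ n h] at this
          exact this
        · exact hs₂ n h x hxF
  let ι : M ↪[𝓗.language] Option M := embeddingOfIff some (Option.some_injective M)
    (fun x => by
      refine ⟨fun hx => ?_, fun hx => Or.inl ⟨x, hx, rfl⟩⟩
      rcases hx with ⟨x', hx, h⟩ | ⟨τ, x', hx, hxF, h⟩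
      · rwa [show x = x' from funext fun i => Option.some_injective M (congrFun h i)]
      · have := congrFun h (τ.symm 0)
        simp at this)
    (fun η a => (hbr.lies_iff η a).symm)
  have hnone : ∀ x : Fin d → M, (∀ l, x l ∈ F) →
      (𝓗.Edge (Fin.cons none fun l => some (x l)) ↔ x ∈ P) := by
    intro x hx
    refine ⟨fun h => ?_, fun h => Or.inr ⟨1, x, h, hx, rfl⟩⟩
    rcases h with ⟨x', -, h⟩ | ⟨τ, x', hx', -, h⟩
    · have := congrFun h 0
      simp at this
    -- Both tuples have the new point exactly at coordinate `0`, so `τ` fixes `0`; the permutation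
    -- of the remaining coordinates is absorbed by the symmetry of `P`.
    · obtain ⟨⟨p, e⟩, rfl⟩ := Equiv.Perm.decomposeFin.symm.surjective τ
      have hp : p = 0 := by
        by_contra hp
        obtain ⟨q, rfl⟩ := Fin.exists_succ_eq.2 hp
        have := congrFun h 0
        simp at this
      subst hp
      rw [Fin.cons_comp_decomposeFin_symm] at h
      have hxe : x = x' ∘ e := funext fun l => by
        have := congrFun h l.succ
        simpa using this
      rw [hxe]
      exact hsymm x' hx' e
  obtain ⟨N, _, hN, ⟨j⟩⟩ := hT.exists_embedding (Option M) hbr'.model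
  let v : Fin F.card → M := fun i => (F.equivFin.symm i : M)
  have hv : ∀ i, v i ∈ F := fun i => (F.equivFin.symm i).2
  -- `M` is embedded in two models of `T`, itself and `N`, so a formula with parameters from `F`
  -- that the new point makes true in `N` is true in `M`.
  have hreal := hT.complete_diagram M M N hbr.model hM hN (Embedding.refl _ M) (j.comp ι) _
    (pointFormula (Node.ofBranch ρ m) {g | (fun l => v (g l)) ∈ P}) v
  have hjN : (pointFormula (Node.ofBranch ρ m) {g | (fun l => v (g l)) ∈ P}).Realize
      (j.comp ι ∘ v) := by
    rw [realize_pointFormula]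
    refine ⟨j none, fun i h => ?_, ?_, fun g => ?_⟩
    · have := j.injective h
      cases this
    · rw [lies_embedding]
      exact fun n hn => (hs₁ n hn).symm
    · have := hnone (fun l => v (g l)) fun l => hv _
      rw [← edge_embedding j, Fin.comp_cons_apply] at this
      exact this
  obtain ⟨c, hc, hl, hG⟩ := (realize_pointFormula _ _ _).1 (hreal.2 hjN)
  refine ⟨c, fun hcF => ?_, hl, fun x hx => ?_⟩
  · refine hc (F.equivFin ⟨c, hcF⟩) ?_
    change c = v _
    simp [v]
  · have := hG fun l => F.equivFin ⟨x l, hx l⟩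
    simpa [v] using this

/-- In a finite model, the extension property over the set of all points would produce a point
outside it. -/
theorem infinite_of_model {T : 𝓗.language.Theory}
    (hT : IsModelCompletion.{u} 𝓗.universalTheory T) {M : Type u} [𝓗.language.Structure M]
    [Nonempty M] (hM : M ⊨ T) : Infinite M := by
  by_contra hfin
  rw [not_infinite_iff_finite] at hfin
  have := Fintype.ofFinite M
  obtain ⟨br, hbr⟩ := exists_isBranching (hT.extends_theory M hM)
  obtain ⟨f, hf⟩ := 𝓗.exists_growth
  obtain ⟨m, hm⟩ := Filter.eventually_atTop.1
    (hf.tendsto.eventually_ge_atTop ((Finset.univ : Finset M).card ^ d))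
  obtain ⟨c, hc, -⟩ := exists_point hT hf hM hbr (br (Classical.arbitrary M)) m Finset.univ hm ∅
    (by simp) (by simp) (by simp)
  exact hc (Finset.mem_univ c)

end Template

/-! ### Separation and nonstandard integers -/

namespace Ultrafilter

variable {I : Type u} {D : Ultrafilter I}

open Cardinal

/-- The class of a sequence in the ultrapower. -/
def cls (D : Ultrafilter I) {M : Type u} (x : I → M) : Ultrapower D M := (x : Ultrapower D M)

theorem exists_cls {M : Type u} (a : Ultrapower D M) : ∃ x : I → M, D.cls x = a :=
  Quotient.exists_rep a

theorem cls_eq_cls {M : Type u} {x y : I → M} :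
    D.cls x = D.cls y ↔ ∀ᶠ i in (D : Filter I), x i = y i :=
  Quotient.eq''

/-- Separation of two parts of a family of sequences of length at most `|I|`. -/
theorem IsGoodForRandomGraph.separate [Infinite I] (hrg : D.IsGoodForRandomGraph) {X : Type u}
    [Infinite X] {κ : Type u} (hκ : #κ ≤ #I) (B : Set κ) (x : κ → I → X)
    (hx : ∀ k ∈ B, ∀ k' ∉ B, ¬ ∀ᶠ i in (D : Filter I), x k i = x k' i) :
    ∃ S : I → Set X, (∀ k ∈ B, ∀ᶠ i in (D : Filter I), x k i ∈ S i) ∧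
      ∀ k ∉ B, ∀ᶠ i in (D : Filter I), x k i ∉ S i := by
  let q : κ → Ultrapower D X := fun k => D.cls (x k)
  have hcard : ∀ s : Set κ, #(q '' s) ≤ #I := fun s =>
    (mk_image_le.trans (mk_set_le s)).trans hκ
  obtain ⟨P, ⟨S, hS⟩, hP, hP'⟩ := hrg X (q '' B) (q '' Bᶜ)
    ((add_le_add (hcard _) (hcard _)).trans (add_eq_self (aleph0_le_mk I)).le) (by
      rw [Set.disjoint_left]
      rintro _ ⟨k, hk, rfl⟩ ⟨k', hk', h⟩
      exact hx k hk k' hk' (cls_eq_cls.1 h.symm))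
  refine ⟨S, fun k hk => (hS _).1 (hP ⟨k, hk, rfl⟩), fun k hk => ?_⟩
  rw [Ultrafilter.eventually_not]
  exact fun h => Set.disjoint_left.1 hP' ⟨k, hk, rfl⟩ ((hS _).2 h)

/-- The number of members of the regularizing family that contain `i` is nonstandard, since any `m +
1` of them meet in a set of `D`. -/
theorem IsRegular.exists_nonstandard [Infinite I] (hreg : D.IsRegular) :
    ∃ h : I → ℕ, ∀ m : ℕ, ∀ᶠ i in (D : Filter I), m < h i := by
  obtain ⟨X, hX, hfin⟩ := hreg
  refine ⟨fun i => {α | i ∈ X α}.ncard, fun m => ?_⟩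
  obtain ⟨s, hs⟩ := Infinite.exists_subset_card_eq I (m + 1)
  have : ∀ᶠ i in (D : Filter I), ∀ α ∈ s, i ∈ X α :=
    (Filter.eventually_all_finset s).2 fun α _ => hX α
  filter_upwards [this] with i hi
  have := Set.ncard_le_ncard (s := (s : Set I)) (fun α hα => hi α hα) (hfin i)
  rw [Set.ncard_coe_finset, hs] at this
  exact this

/-- At most `|I|` many nonstandard integers have a nonstandard lower bound. -/
theorem IsGoodForRandomGraph.exists_nonstandard_le [Infinite I] (hrg : D.IsGoodForRandomGraph)
    (hreg : D.IsRegular) {κ : Type u} (hκ : #κ ≤ #I) (g : κ → I → ℕ)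
    (hg : ∀ k (m : ℕ), ∀ᶠ i in (D : Filter I), m < g k i) :
    ∃ n : I → ℕ, (∀ m : ℕ, ∀ᶠ i in (D : Filter I), m < n i) ∧
      ∀ k, ∀ᶠ i in (D : Filter I), n i ≤ g k i := by
  obtain ⟨h, hh⟩ := hreg.exists_nonstandard
  -- An internal set `S` containing the standard integers and omitting all `g k` has a nonstandard
  -- least non-element, which bounds every `g k` from below. The extra `h` ensures that a
  -- non-element exists even if `κ` is empty.
  let g' : Option κ → I → ℕ := fun k => k.elim h g
  have hg' : ∀ k (m : ℕ), ∀ᶠ i in (D : Filter I), m < g' k i := fun k => by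
    cases k with
    | none => exact hh
    | some k => exact hg k
  have hI := aleph0_le_mk I
  have hcard : #(ULift.{u} ℕ ⊕ Option κ) ≤ #I := by
    rw [mk_sum, lift_id, lift_id, mk_option, mk_uLift, mk_nat, lift_aleph0]
    exact add_le_of_le hI hI (add_le_of_le hI hκ (one_le_aleph0.trans hI))
  obtain ⟨S, hS, hS'⟩ := hrg.separate hcard (Set.range Sum.inl)
    (fun k i => k.elim id fun k => ULift.up (g' k i)) (by
      rintro _ ⟨⟨m⟩, rfl⟩ (k' | k') hk' h
      · exact hk' ⟨k', rfl⟩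
      · obtain ⟨i, hi, hi'⟩ := (h.and (hg' k' m)).exists
        have : m = g' k' i := congrArg ULift.down hi
        omega)
  have hle : ∀ k, ∀ᶠ i in (D : Filter I), sInf {n : ℕ | ULift.up n ∉ S i} ≤ g' k i := fun k => by
    filter_upwards [hS' (Sum.inr k) (by simp)] with i hi
    exact Nat.sInf_le hi
  refine ⟨fun i => sInf {n : ℕ | ULift.up n ∉ S i}, fun m => ?_, fun k => hle (some k)⟩
  have : ∀ᶠ i in (D : Filter I), ∀ n ∈ Finset.range (m + 1), ULift.up n ∈ S i :=
    (Filter.eventually_all_finset _).2 fun n _ => hS (Sum.inl ⟨n⟩) ⟨_, rfl⟩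
  filter_upwards [this, hS' (Sum.inr none) (by simp)] with i hi hne
  by_contra hlt
  exact Nat.sInf_mem (s := {n : ℕ | ULift.up n ∉ S i}) ⟨_, hne⟩
    (hi _ (Finset.mem_range.2 (by omega)))

/-- A nonstandard integer whose powers lie below a function tending to infinity. -/
theorem exists_nonstandard_pow_le {f : ℕ → ℕ} (hf : Filter.Tendsto f Filter.atTop Filter.atTop)
    {d : ℕ} (hd : 1 ≤ d) {n : I → ℕ} (hn : ∀ m : ℕ, ∀ᶠ i in (D : Filter I), m < n i) :
    ∃ r : I → ℕ, (∀ m : ℕ, ∀ᶠ i in (D : Filter I), m < r i) ∧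
      ∀ i k, n i ≤ k → r i ^ d ≤ f k := by
  classical
  let p : I → ℕ → Prop := fun i m => ∀ k, n i ≤ k → m ^ d ≤ f k
  -- The bound `n i` only keeps the search finite. As `d ≥ 1`, the value `0` always qualifies, so
  -- the inequality holds at every index.
  refine ⟨fun i => Nat.findGreatest (p i) (n i), fun m => ?_, fun i => ?_⟩
  · obtain ⟨N, hN⟩ := Filter.eventually_atTop.1 (hf.eventually_ge_atTop ((m + 1) ^ d))
    filter_upwards [hn m, hn N] with i h1 h2
    exact Nat.le_findGreatest h1 fun k hk => hN k (h2.le.trans hk)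
  · refine Nat.findGreatest_spec (P := p i) (m := 0) (Nat.zero_le _) fun k _ => ?_
    rw [zero_pow (by omega)]
    exact Nat.zero_le _

end Ultrafilter

/-! ### Realizing a branch and a set of edges in the ultrapower -/

namespace Template

open FirstOrder.Language Structure Cardinal

variable {d : ℕ} {𝓗 : Template d}

section Ultrapowers

variable {I : Type u} {D : Ultrafilter I} {M : Type u}

theorem realize_cls {L : FirstOrder.Language} [L.Structure M] [Nonempty M] {α : Type*}
    (φ : L.Formula α) (x : α → I → M) :
    (φ.Realize fun a => D.cls (x a)) ↔ ∀ᶠ i in (D : Filter I), φ.Realize fun a => x a i :=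
  Ultraproduct.realize_formula_cast φ x

theorem model_ultrapower {L : FirstOrder.Language} [L.Structure M] [Nonempty M] {T : L.Theory}
    (h : M ⊨ T) : Ultrapower D M ⊨ T := by
  rw [Theory.model_iff]
  exact fun φ hφ => (Ultraproduct.sentence_realize φ).2
    (Filter.Eventually.of_forall fun _ => (Theory.model_iff _).1 h φ hφ)

variable [𝓗.language.Structure M]

theorem edge_cls (x : Fin (d + 1) → I → M) :
    𝓗.Edge (fun j => D.cls (x j)) ↔ ∀ᶠ i in (D : Filter I), 𝓗.Edge fun j => x j i :=
  relMap_quotient_mk' (s := (D : Filter I).productSetoid fun _ => M)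
    (ps := Ultraproduct.setoidPrestructure (fun _ => M) D) 𝓗.relR x

theorem lies_cls (η : 𝓗.Node) (x : I → M) :
    Lies η (D.cls x) ↔ ∀ᶠ i in (D : Filter I), Lies η (x i) :=
  relMap_quotient_mk' (s := (D : Filter I).productSetoid fun _ => M)
    (ps := Ultraproduct.setoidPrestructure (fun _ => M) D) (𝓗.relQ η) fun _ => x

/-- One predicate decides the first `n + 1` entries of a branch. The agreement is for each `n`
separately; infinitely many levels need not agree at a common index. -/
theorem IsBranching.branch_cls {br : M → ∀ n, Fin (𝓗.H n)} (hbr : 𝓗.IsBranching br)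
    {br' : Ultrapower D M → ∀ n, Fin (𝓗.H n)} (hbr' : 𝓗.IsBranching br') (x : I → M) (n : ℕ) :
    ∀ᶠ i in (D : Filter I), br (x i) n = br' (D.cls x) n := by
  filter_upwards [(lies_cls _ x).1 (hbr'.lies_ofBranch (D.cls x) (n + 1))] with i hi
  exact hbr.branch_eq hi (Nat.lt_succ_self n)

end Ultrapowers

/-- Realization of a consistent set of literals over at most `|I|` many elements of the
ultrapower. -/
theorem exists_point_ultrapower {T : 𝓗.language.Theory}
    (hT : IsModelCompletion.{u} 𝓗.universalTheory T) {I : Type u} [Infinite I]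
    {D : Ultrafilter I} (hreg : D.IsRegular) (hflex : D.IsFlexible)
    (hrg : D.IsGoodForRandomGraph) {M : Type u} [𝓗.language.Structure M] [Nonempty M]
    (hM : M ⊨ T) {br' : Ultrapower D M → ∀ n, Fin (𝓗.H n)} (hbr' : 𝓗.IsBranching br')
    (A : Set (Ultrapower D M)) (hA : #A ≤ #I) (ρ : ∀ n, Fin (𝓗.H n)) (B : Set (Fin d → A))
    (hsymm : ∀ x ∈ B, ∀ σ : Equiv.Perm (Fin d), x ∘ σ ∈ B)
    (hinj : ∀ x ∈ B, Function.Injective x)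
    (hE : ∀ x ∈ B, ∀ n,
      (Fin.cons (ρ n) fun l => br' (x l) n : Fin (d + 1) → Fin (𝓗.H n)) ∈ 𝓗.E n) :
    ∃ c : Ultrapower D M, c ∉ A ∧ (∀ n, Lies (Node.ofBranch ρ n) c) ∧
      ∀ x : Fin d → A, 𝓗.Edge (Fin.cons c fun l => (x l : Ultrapower D M)) ↔ x ∈ B := by
  classical
  obtain ⟨br, hbr⟩ := exists_isBranching (hT.extends_theory M hM)
  obtain ⟨f, hf⟩ := 𝓗.exists_growth
  have hinfM : Infinite M := infinite_of_model hT hM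
  have : NeZero d := ⟨(Nat.one_le_iff_ne_zero.1 𝓗.one_le)⟩
  have hinfMd : Infinite (Fin d → M) := inferInstance
  have hAd : #(Fin d → A) ≤ #I := by
    rw [mk_arrow, mk_fin, lift_natCast, lift_uzero]
    exact (Cardinal.power_le_power_right hA).trans (power_nat_le (aleph0_le_mk I))
  choose rep hrep using fun a : A => Ultrafilter.exists_cls (a : Ultrapower D M)
  have hne : ∀ a a' : A, (∀ᶠ i in (D : Filter I), rep a i = rep a' i) → a = a' := by
    intro a a' h
    have := Ultrafilter.cls_eq_cls.2 h
    rw [hrep, hrep] at this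
    exact Subtype.ext this
  -- Tuples of representatives are single elements of the ultrapower of `Fin d → M`, so separating
  -- sets of elements separates the `d`-ary relation `B` from its complement.
  obtain ⟨S, hS, hS'⟩ := hrg.separate hAd B (fun x i l => rep (x l) i) (by
    intro x hx y hy h
    have : x = y := funext fun l => hne _ _ (h.mono fun i hi => congrFun hi l)
    exact hy (this ▸ hx))
  -- The level up to which the tuples in `B` are compatible with `ρ`
  obtain ⟨h, hh⟩ := hreg.exists_nonstandard
  let bad : (Fin d → A) → I → ℕ → Prop := fun x i n =>
    (Fin.cons (ρ n) fun l => br (rep (x l) i) n : Fin (d + 1) → Fin (𝓗.H n)) ∉ 𝓗.E n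
  -- The cap `h i` keeps the set nonempty where no level is bad; the infimum would otherwise be `0`.
  let g : B → I → ℕ := fun x i => sInf {n | n = h i ∨ bad x i n}
  have hg : ∀ x m, ∀ᶠ i in (D : Filter I), m < g x i := by
    intro x m
    -- Up to a standard level the branches of representatives agree with those of their classes,
    -- which are compatible with `ρ` by `hE`.
    have : ∀ᶠ i in (D : Filter I), ∀ n ∈ Finset.range (m + 1), ∀ l,
        br (rep (x.1 l) i) n = br' (x.1 l) n := by
      refine (Filter.eventually_all_finset _).2 fun n _ => Filter.eventually_all.2 fun l => ?_
      have := hbr.branch_cls hbr' (rep (x.1 l)) n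
      rwa [hrep] at this
    filter_upwards [this, hh m] with i hi hm
    by_contra hlt
    rcases Nat.sInf_mem (s := {n | n = h i ∨ bad x i n}) ⟨h i, Or.inl rfl⟩ with h1 | h1
    · change g x i = h i at h1
      omega
    · refine h1 ?_
      have := hE x x.2 (g x i)
      simp only [← hi (g x i) (Finset.mem_range.2 (by omega))] at this
      exact this
  obtain ⟨n, hn, hng⟩ := hrg.exists_nonstandard_le hreg ((mk_set_le B).trans hAd) g hg
  -- From level `n i` on, `f` allows all `d`-tuples from `r i` parameters to be handled at once;
  -- flexibility then lets index `i` see at most `r i` of them.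
  obtain ⟨r, hr, hrf⟩ := Ultrafilter.exists_nonstandard_pow_le hf.tendsto 𝓗.one_le hn
  obtain ⟨X, hX, hXr⟩ := hflex r hr
  obtain ⟨e⟩ : Nonempty (A ↪ I) := hA
  have hfin : ∀ i, {a : A | i ∈ X (e a)}.encard ≤ r i := fun i => by
    refine le_trans ?_ (hXr i)
    exact Set.encard_le_encard_of_injOn (f := e) (fun a ha => ha) e.injective.injOn
  have hfin' : ∀ i, {a : A | i ∈ X (e a)}.Finite := fun i =>
    Set.finite_of_encard_le_coe (hfin i)
  let F : I → Finset M := fun i => (hfin' i).toFinset.image fun a => rep a i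
  have hF : ∀ i, (F i).card ≤ r i := fun i => by
    refine Finset.card_image_le.trans ?_
    have := hfin i
    rw [(hfin' i).encard_eq_coe_toFinset_card] at this
    exact_mod_cast this
  have hrepF : ∀ a : A, ∀ᶠ i in (D : Filter I), rep a i ∈ F i := fun a => by
    filter_upwards [hX (e a)] with i hi
    exact Finset.mem_image_of_mem _ ((hfin' i).mem_toFinset.2 hi)
  -- `S i` is trimmed so that the hypotheses of `exists_point` hold at every index. Each tuple in
  -- `B` survives the trimming almost everywhere.
  let P : I → Set (Fin d → M) := fun i => {x | (∀ σ : Equiv.Perm (Fin d), x ∘ σ ∈ S i) ∧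
    Function.Injective x ∧ ∀ k < n i,
      (Fin.cons (ρ k) fun l => br (x l) k : Fin (d + 1) → Fin (𝓗.H k)) ∈ 𝓗.E k}
  have hpt := fun i => exists_point hT hf hM hbr ρ (n i) (F i)
    (fun k hk => (Nat.pow_le_pow_left (hF i) d).trans (hrf i k hk)) (P i)
    (fun x hx σ => ⟨fun τ => hx.1 (τ.trans σ), hx.2.1.comp σ.injective, fun k hk => by
      have := (𝓗.full k).comp_perm_mem (hx.2.2 k hk) (Equiv.Perm.decomposeFin.symm (0, σ))
      rwa [Fin.cons_comp_decomposeFin_symm] at this⟩)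
    (fun x hx => hx.2.1) fun x hx => hx.2.2
  choose c hcF hcρ hcP using hpt
  refine ⟨D.cls c, fun hcA => ?_, fun m => ?_, fun x => ?_⟩
  · have hc := Ultrafilter.cls_eq_cls.1 (hrep ⟨_, hcA⟩)
    obtain ⟨i, h1, h2⟩ := (hc.and (hrepF ⟨_, hcA⟩)).exists
    exact hcF i (h1 ▸ h2)
  · rw [lies_cls]
    filter_upwards [hn m] with i hi
    exact (hbr.lies_iff _ _).2 fun k hk => (hbr.branch_eq (hcρ i) (hk.trans hi)).symm
  · have h1 : (Fin.cons (D.cls c) fun l => (x l : Ultrapower D M) :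
        Fin (d + 1) → Ultrapower D M) = fun j =>
        D.cls ((Fin.cons c fun l => rep (x l) : Fin (d + 1) → I → M) j) := by
      rw [Fin.comp_cons_apply]
      simp only [hrep]
    rw [h1, edge_cls]
    have h2 : ∀ᶠ i in (D : Filter I), (𝓗.Edge (fun j =>
        (Fin.cons c fun l => rep (x l) : Fin (d + 1) → I → M) j i) ↔
          (fun l => rep (x l) i) ∈ P i) := by
      filter_upwards [Filter.eventually_all.2 fun l => hrepF (x l)] with i hi
      rw [Fin.comp_cons_apply fun y : I → M => y i]
      exact hcP i _ hi
    rw [Filter.eventually_congr h2]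
    by_cases hx : x ∈ B
    · refine iff_of_true ?_ hx
      have h3 : ∀ᶠ i in (D : Filter I), ∀ σ : Equiv.Perm (Fin d),
          (fun l => rep (x l) i) ∘ σ ∈ S i :=
        Filter.eventually_all.2 fun σ => hS _ (hsymm x hx σ)
      have h4 : ∀ᶠ i in (D : Filter I), ∀ l l', rep (x l) i = rep (x l') i → l = l' := by
        refine Filter.eventually_all.2 fun l => Filter.eventually_all.2 fun l' => ?_
        by_cases hll : l = l'
        · exact Filter.Eventually.of_forall fun _ _ => hll
        · have : ∀ᶠ i in (D : Filter I), ¬ rep (x l) i = rep (x l') i :=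
            Ultrafilter.eventually_not.2 fun h => hll (hinj x hx (hne _ _ h))
          exact this.mono fun i hi h => absurd h hi
      filter_upwards [h3, h4, hng ⟨x, hx⟩] with i h3 h4 h5
      refine ⟨h3, h4, fun k hk => ?_⟩
      by_contra hbad
      exact absurd (Nat.sInf_le (s := {n | n = h i ∨ bad x i n}) (Or.inr hbad))
        (not_le.2 (hk.trans_le h5))
    · refine iff_of_false ?_ hx
      rw [← Ultrafilter.eventually_not]
      filter_upwards [hS' x hx] with i hi hP
      exact hi (hP.1 1)

end Template

/-! ### From edges and branches to complete types -/

namespace Template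

open FirstOrder.Language Structure Cardinal

variable {d : ℕ} {𝓗 : Template d}

/-- The diagonal embedding into an ultrapower. -/
def diagonal {J : Type u} (U : Ultrafilter J) (N : Type u) [𝓗.language.Structure N] :
    N ↪[𝓗.language] Ultrapower U N :=
  embeddingOfIff (fun a => U.cls fun _ => a)
    (fun _ _ h => Filter.eventually_const.1 (Ultrafilter.cls_eq_cls.1 h))
    (fun x => (edge_cls fun i _ => x i).trans Filter.eventually_const)
    (fun η a => (lies_cls η fun _ => a).trans Filter.eventually_const)

/-- Two maps of `Option A` into models of the universal theory, with the same edges among the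
parameters and at the new point, and with the same branches, have the same edges. -/
theorem edge_option_iff {A N₁ N₂ : Type u} [𝓗.language.Structure N₁] [𝓗.language.Structure N₂]
    {br₁ : N₁ → ∀ n, Fin (𝓗.H n)} {br₂ : N₂ → ∀ n, Fin (𝓗.H n)} (h₁ : 𝓗.IsBranching br₁)
    (h₂ : 𝓗.IsBranching br₂) (f₁ : Option A → N₁) (f₂ : Option A → N₂)
    (hA : ∀ x : Fin (d + 1) → A,
      𝓗.Edge (fun i => f₁ (some (x i))) ↔ 𝓗.Edge (fun i => f₂ (some (x i))))
    (hnew : ∀ x : Fin d → A, 𝓗.Edge (Fin.cons (f₁ none) fun l => f₁ (some (x l))) ↔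
      𝓗.Edge (Fin.cons (f₂ none) fun l => f₂ (some (x l))))
    (y : Fin (d + 1) → Option A) :
    𝓗.Edge (fun i => f₁ (y i)) ↔ 𝓗.Edge (fun i => f₂ (y i)) := by
  by_cases hy : Function.Injective y
  · by_cases hnone : ∃ i, y i = none
    · obtain ⟨i, hi⟩ := hnone
      let σ := Equiv.swap 0 i
      have hσ : (y ∘ σ) 0 = none := by simpa [σ] using hi
      have hsome : ∀ l : Fin d, ∃ a, (y ∘ σ) l.succ = some a := fun l => by
        refine Option.ne_none_iff_exists'.1 fun h => ?_
        -- An injective tuple contains the new point at most once, and the swap has moved it to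
        -- coordinate `0`.
        exact Fin.succ_ne_zero l ((hy.comp σ.injective) (h.trans hσ.symm))
      choose x hx using hsome
      have hcons : y ∘ σ = Fin.cons none fun l => some (x l) := by
        funext l
        refine Fin.cases hσ (fun l => ?_) l
        rw [hx, Fin.cons_succ]
      have key : ∀ {N : Type u} (f : Option A → N),
          (fun i => f (y i)) ∘ σ = Fin.cons (f none) fun l => f (some (x l)) := fun f => by
        rw [← Fin.comp_cons_apply, ← hcons]
        rfl
      rw [← h₁.edge_comp_perm_iff _ σ, ← h₂.edge_comp_perm_iff _ σ, key, key]
      exact hnew x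
    · have hsome : ∀ i, ∃ a, y i = some a := fun i =>
        Option.ne_none_iff_exists'.1 fun h => hnone ⟨i, h⟩
      choose x hx using hsome
      obtain rfl : y = fun i => some (x i) := funext hx
      exact hA x
  · exact iff_of_false (fun h => hy fun i l hil => h₁.injective _ h (congrArg f₁ hil))
      fun h => hy fun i l hil => h₂.injective _ h (congrArg f₂ hil)

/-- The complete type over `A` of a point `b` of an ultrapower of `M ^ I / D` is realized. -/
theorem exists_realize_iff {T : 𝓗.language.Theory}
    (hT : IsModelCompletion.{u} 𝓗.universalTheory T) {I : Type u} [Infinite I]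
    {D : Ultrafilter I} (hreg : D.IsRegular) (hflex : D.IsFlexible)
    (hrg : D.IsGoodForRandomGraph) {M : Type u} [𝓗.language.Structure M] [Nonempty M]
    (hM : M ⊨ T) (A : Set (Ultrapower D M)) (hA : #A ≤ #I) {J : Type u} (U : Ultrafilter J)
    (b : Ultrapower U (Ultrapower D M)) :
    ∃ c : Ultrapower D M, ∀ ψ : 𝓗.language.Formula (A ⊕ Unit),
      ψ.Realize (Sum.elim (fun a => U.cls fun _ => (a : Ultrapower D M)) fun _ => b) ↔
        ψ.Realize (Sum.elim (fun a => (a : Ultrapower D M)) fun _ => c) := by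
  have hN : Ultrapower D M ⊨ T := model_ultrapower hM
  have hN' : Ultrapower U (Ultrapower D M) ⊨ T := model_ultrapower hN
  obtain ⟨br, hbr⟩ := exists_isBranching (hT.extends_theory _ hN)
  obtain ⟨br', hbr'⟩ := exists_isBranching (hT.extends_theory _ hN')
  let j : Ultrapower D M ↪[𝓗.language] Ultrapower U (Ultrapower D M) := diagonal U _
  have hj : ∀ a n, br' (j a) n = br a n := fun a n =>
    hbr'.branch_eq ((lies_embedding j _ a).2 (hbr.lies_ofBranch a (n + 1))) (Nat.lt_succ_self n)
  -- A point on the diagonal already has its type realized below. Otherwise `b` differs from all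
  -- parameters, as the point `c ∉ A` constructed below does.
  by_cases hb : ∃ a, j a = b
  · obtain ⟨a, rfl⟩ := hb
    refine ⟨a, fun ψ => ?_⟩
    have h : (Sum.elim (fun a : A => U.cls fun _ => (a : Ultrapower D M)) fun _ : Unit => j a) =
        fun x => U.cls fun _ =>
          (Sum.elim (fun a : A => (a : Ultrapower D M)) fun _ : Unit => a) x := by
      funext x
      cases x <;> rfl
    rw [h, realize_cls, Filter.eventually_const]
  · let B : Set (Fin d → A) := {x | 𝓗.Edge (Fin.cons b fun l => j (x l))}
    obtain ⟨c, hcA, hcρ, hcB⟩ := exists_point_ultrapower hT hreg hflex hrg hM hbr A hA (br' b) B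
      (fun x hx σ => by
        have := hbr'.symm _ (Equiv.Perm.decomposeFin.symm (0, σ)) hx
        rwa [Fin.cons_comp_decomposeFin_symm] at this)
      (fun x hx => by
        have := (Fin.cons_injective_iff.1 (hbr'.injective _ hx)).2
        exact fun l l' h => this (congrArg (fun a : A => j a) h))
      (fun x hx n => by
        have := hbr'.mem_edges _ hx n
        rw [Fin.comp_cons_apply fun a => br' a n] at this
        simpa only [hj] using this)
    let f₁ : Option A → Ultrapower U (Ultrapower D M) := fun a => a.elim b fun a => j a
    let f₂ : Option A → Ultrapower D M := fun a => a.elim c fun a => a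
    have hf₁ : Function.Injective f₁ := by
      rintro (_ | a) (_ | a') h
      · rfl
      · exact absurd ⟨_, h.symm⟩ hb
      · exact absurd ⟨_, h⟩ hb
      · exact congrArg some (Subtype.ext (j.injective h))
    have hf₂ : Function.Injective f₂ := by
      rintro (_ | a) (_ | a') h
      · rfl
      · exact absurd ((show c = a' from h) ▸ a'.2) hcA
      · exact absurd ((show a = c from h) ▸ a.2) hcA
      · exact congrArg some (Subtype.ext h)
    have hbr₁₂ : ∀ a n, br (f₂ a) n = br' (f₁ a) n := by
      rintro (_ | a) n
      · exact hbr.branch_eq (hcρ (n + 1)) (Nat.lt_succ_self n)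
      · exact (hj a n).symm
    -- The structure induced on `A` together with `b` embeds into both ultrapowers, sending the new
    -- point to `b` and to `c`; completeness of its diagram identifies the two types.
    let _ : 𝓗.language.Structure (Option A) :=
      structureOfBranches {y | 𝓗.Edge fun i => f₁ (y i)} fun a => br' (f₁ a)
    have hK : 𝓗.IsBranching fun a : Option A => br' (f₁ a) :=
      ⟨fun η a => Iff.rfl, fun x σ hx => hbr'.symm _ σ hx,
        fun x hx i i' h => hbr'.injective _ hx (congrArg f₁ h),
        fun x hx n => hbr'.mem_edges _ hx n⟩
    let g₁ : Option A ↪[𝓗.language] Ultrapower U (Ultrapower D M) :=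
      embeddingOfIff f₁ hf₁ (fun x => Iff.rfl) fun η a => hbr'.lies_iff η (f₁ a)
    let g₂ : Option A ↪[𝓗.language] Ultrapower D M :=
      embeddingOfIff f₂ hf₂
        (fun x => (edge_option_iff hbr' hbr f₁ f₂ (fun x => edge_embedding j _)
          (fun x => (hcB x).symm) x).symm)
        fun η a => (hbr.lies_iff η (f₂ a)).trans (by simp only [hbr₁₂]; rfl)
    refine ⟨c, fun ψ => ?_⟩
    have h₁ : (Sum.elim (fun a : A => U.cls fun _ => (a : Ultrapower D M)) fun _ : Unit => b) =
        g₁ ∘ Sum.elim some fun _ => none := by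
      funext x
      cases x <;> rfl
    have h₂ : (Sum.elim (fun a : A => (a : Ultrapower D M)) fun _ : Unit => c) =
        g₂ ∘ Sum.elim some fun _ => none := by
      funext x
      cases x <;> rfl
    rw [h₁, h₂]
    exact hT.realize_iff hK.model hN' hN g₁ g₂ ψ _

end Template

theorem mainTheorem3 {d : ℕ} (𝓗 : Template d) (T : 𝓗.language.Theory)
    (hT : IsModelCompletion.{u} 𝓗.universalTheory T)
    {I : Type u} [Infinite I] (D : Ultrafilter I)
    (hreg : D.IsRegular) (hflex : D.IsFlexible) (hrg : D.IsGoodForRandomGraph)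
    (M : Type u) [𝓗.language.Structure M] [Nonempty M] (hM : M ⊨ T) :
    IsSaturated 𝓗.language (Ultrapower D M) (Order.succ (Cardinal.mk I)) := by
  classical
  intro A hA p hp
  have hrealize : ∀ (φ : 𝓗.language[[A]].Formula Unit) (a : Ultrapower D M),
      φ.Realize (fun _ => a) ↔
        Language.Formula.Realize (Language.BoundedFormula.constantsVarsEquiv φ)
          (Sum.elim (fun a : A => (a : Ultrapower D M)) fun _ => a) := fun φ a =>
    Language.BoundedFormula.realize_constantsVarsEquiv.symm
  have hfin : ∀ s : Finset p, ∃ a : Ultrapower D M, ∀ φ ∈ s, φ.1.Realize fun _ => a := fun s => by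
    obtain ⟨a, ha⟩ := hp (Subtype.val '' (s : Set p)) (by simp) (s.finite_toSet.image _)
    exact ⟨a, fun φ hφ => ha _ ⟨φ, hφ, rfl⟩⟩
  choose b hb using hfin
  -- `U` contains every cone of finite sets above a given one, so the class of the partial solutions
  -- `b s` satisfies all of `p`.
  let U : Ultrafilter (Finset p) := Ultrafilter.of Filter.atTop
  obtain ⟨c, hc⟩ := Template.exists_realize_iff hT hreg hflex hrg hM A (Order.lt_succ_iff.1 hA) U
    (U.cls b)
  refine ⟨c, fun φ hφ => ?_⟩
  rw [hrealize, ← hc]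
  have h : (Sum.elim (fun a : A => U.cls fun _ => (a : Ultrapower D M)) fun _ : Unit => U.cls b) =
      fun x => U.cls
        ((Sum.elim (fun (a : A) (_ : Finset p) => (a : Ultrapower D M)) fun _ : Unit => b) x) := by
    funext x
    cases x <;> rfl
  rw [h, Template.realize_cls]
  have hU : ∀ᶠ s in (U : Filter (Finset p)), {⟨φ, hφ⟩} ≤ s :=
    Ultrafilter.of_le Filter.atTop (Filter.eventually_ge_atTop _)
  filter_upwards [hU] with s hs
  have := (hrealize φ (b s)).1 (hb s ⟨φ, hφ⟩ (hs (Finset.mem_singleton_self _)))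
  convert! this using 1
  funext x
  cases x <;> rfl
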